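/- **Setting.** Let $\mathcal U$ be a universe. A turnstile stream of length $T$ is a sequence $x=(x[1],\dots,x[T])$ whose entries are insertions $+u$, deletions $-u$ $(u\in\mathcal U)$ or no-ops $\bot$. For $u\in\mathcal U$, the existence vector $f_u(x)\in\{0,1\}^T$ has $f_u(x)[t]=1$ if and only if $x[1],\dots,x[t]$ contain strictly more insertions than deletions of $u$. Let $\mathsf{CountDistinct}(x)[t]=\sum_{u\in\mathcal U}f_u(x)[t]$, let $\mathsf{flip}(u,x)=|\{j\in\{1,\dots,T-1\}: f_u(x)[j]\ne f_u(x)[j+1]\}|$, and let $w_x=\max_{u\in\mathcal U}\mathsf{flip}(u,x)$ be the maximum flippancy of $x$ (with $w_x=0$ if $\mathcal U=\emptyset$). A continual-release mechanism for streams of length $T$ is a randomized map that sends a stream $x$ to a vector $M(x)\in\mathbb R^T$ of answers, where the $t$-th answer depends only on the random coins of the mechanism and on $x[1],\dots,x[t]$. Two streams are item-neighbors if one is obtained from the other by replacing with $\bot$ a subset of the entries pertaining to a single element $u\in\mathcal U$. The mechanism is $(\varepsilon,\delta)$-item-level-DP if $\Pr[M(x)\in S]\le e^{\varepsilon}\Pr[M(x')\in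 S]+\delta$ for all item-neighbors $x,x'$ and all measurable $S\subseteq\mathbb R^T$. All logarithms are to base $2$. **Theorem.** There are universal constants $C>0$ and $k,T_0\in\mathbb N$ such that, for every universe $\mathcal U$, all $\varepsilon,\delta\in(0,1]$ and all integers $T\ge T_0$, there is an $(\varepsilon,\delta)$-item-level-DP continual-release mechanism $M$ for turnstile streams of length $T$ over $\mathcal U$ such that, for every such stream $x$, $$\Pr\Big[\max_{1\le t\le T}\big|M(x)[t]-\mathsf{CountDistinct}(x)[t]\big|\le\alpha_x\Big]\ge 0.99,$$ where $$\alpha_x=C\,(\log T)^k\cdot\min\left(\big(\sqrt{w_x}\,\log T+\log^3T\big)\cdot\frac{\sqrt{\log(1/\delta)}}{\varepsilon},\ \frac{\big(T\log(1/\delta)\big)^{1/3}}{\varepsilon^{2/3}},\ T\right).$$ The mechanism may depend on $\mathcal U,\varepsilon,\delta,T$, but it does not depend on $x$ or $w_x$. -/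

import Mathlib

open MeasureTheory

/-- A stream entry over the universe `U`: an insertion `+u`, a deletion `-u`, or a no-op `⊥`. -/
inductive StreamEntry (U : Type*) where
  | noop : StreamEntry U
  | ins (u : U) : StreamEntry U
  | del (u : U) : StreamEntry U

/-- A turnstile stream of length `T`. The entry at time `t ∈ {1, …, T}` has index `t - 1`. -/
abbrev TurnstileStream (U : Type*) (T : ℕ) := Fin T → StreamEntry U

/-- The entry is an insertion or a deletion of `u`. -/
def StreamEntry.PertainsTo {U : Type*} (e : StreamEntry U) (u : U) : Prop :=
  e = StreamEntry.ins u ∨ e = StreamEntry.del u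

namespace TurnstileStream

variable {U : Type*} {T : ℕ}

/-- The number of insertions of `u` up to and including time `t`. -/
noncomputable def insertions (x : TurnstileStream U T) (u : U) (t : Fin T) : ℕ :=
  Set.ncard {s : Fin T | s ≤ t ∧ x s = StreamEntry.ins u}

/-- The number of deletions of `u` up to and including time `t`. -/
noncomputable def deletions (x : TurnstileStream U T) (u : U) (t : Fin T) : ℕ :=
  Set.ncard {s : Fin T | s ≤ t ∧ x s = StreamEntry.del u}

/-- The existence vector of `u`: its entry at `t` is `1` if there are strictly more insertions than
deletions of `u` up to time `t`, and `0` otherwise. -/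
noncomputable def existence (x : TurnstileStream U T) (u : U) (t : Fin T) : ℕ :=
  if x.deletions u t < x.insertions u t then 1 else 0

/-- Only elements that occur in the stream contribute to the number of distinct elements. -/
theorem finite_support_existence (x : TurnstileStream U T) (t : Fin T) :
    (Function.support fun u => x.existence u t).Finite := by
  have h : (StreamEntry.ins ⁻¹' Set.range x : Set U).Finite :=
    (Set.finite_range x).preimage (fun a _ b _ hab => by injection hab)
  refine h.subset fun u hu => ?_
  by_contra hne
  apply hu
  have h0 : x.insertions u t = 0 := by
    have : {s : Fin T | s ≤ t ∧ x s = StreamEntry.ins u} = ∅ := by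
      ext s
      simp only [Set.mem_ofPred_eq, Set.mem_empty_iff_false, iff_false, not_and]
      exact fun _ hs => hne ⟨s, hs⟩
    rw [insertions, this, Set.ncard_empty]
  simp [existence, h0]

/-- The number of distinct elements present at each time: the sum over all `u ∈ U` of the
existence vectors (a sum with finite support, by `finite_support_existence`). -/
noncomputable def countDistinct (x : TurnstileStream U T) (t : Fin T) : ℕ :=
  ∑ᶠ u : U, x.existence u t

/-- The flippancy of `u`: the number of pairs of adjacent entries of its existence vector with
different values. -/
noncomputable def flippancy (x : TurnstileStream U T) (u : U) : ℕ :=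
  Set.ncard {p : Fin T × Fin T |
    (p.1 : ℕ) + 1 = p.2 ∧ x.existence u p.1 ≠ x.existence u p.2}

/-- The flippancies of the elements of `U` are bounded, so that their supremum is a maximum. -/
theorem bddAbove_range_flippancy (x : TurnstileStream U T) :
    BddAbove (Set.range fun u => x.flippancy u) := by
  refine ⟨Set.ncard (Set.univ : Set (Fin T × Fin T)), ?_⟩
  rintro _ ⟨u, rfl⟩
  exact Set.ncard_le_ncard (Set.subset_univ _) Set.finite_univ

/-- The maximum flippancy `w_x` of a stream `x` (`0` over the empty universe). -/
noncomputable def maxFlippancy (x : TurnstileStream U T) : ℕ :=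
  ⨆ u : U, x.flippancy u

/-- `x'` is obtained from `x` by replacing with `⊥` a subset of the entries of `x` that pertain
to a single element `u`. -/
def IsItemErasure (x x' : TurnstileStream U T) : Prop :=
  ∃ u : U, ∀ t : Fin T, x' t = x t ∨ ((x t).PertainsTo u ∧ x' t = StreamEntry.noop)

/-- Item-neighboring streams. -/
def ItemNeighbors (x x' : TurnstileStream U T) : Prop :=
  IsItemErasure x x' ∨ IsItemErasure x' x

/-- The error of a vector of answers for `countDistinct`, in the norm `‖·‖_∞` of `ℝ^T`
(the norm that `Fin T → ℝ` carries). -/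
noncomputable def countDistinctError (x : TurnstileStream U T) (a : Fin T → ℝ) : ℝ :=
  ‖(fun t => (x.countDistinct t : ℝ)) - a‖

end TurnstileStream

/-- A randomized mechanism in the continual release model, for streams of length `T` over `U`:
it draws its random coins `ω` from a probability space and outputs a real number at every time
step, and its output at time `t` depends only on its coins and on the entries of the stream up to
and including time `t`. -/
structure ContinualMechanism (U : Type*) (T : ℕ) where
  /-- The space of random coins. -/
  Coins : Type
  /-- The events about the coins. -/
  mCoins : MeasurableSpace Coins
  /-- The distribution of the coins. -/
  law : @Measure Coins mCoins
  isProbabilityMeasure_law : @IsProbabilityMeasure Coins mCoins law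
  /-- The vector of answers on a given stream and given coins. -/
  output : TurnstileStream U T → Coins → Fin T → ℝ
  measurable_output : ∀ x, Measurable (output x)
  online : ∀ (x x' : TurnstileStream U T) (t : Fin T),
    (∀ s ≤ t, x s = x' s) → ∀ ω, output x ω t = output x' ω t

namespace ContinualMechanism

variable {U : Type*} {T : ℕ}

/-- The probability that the vector of answers on the stream `x` lies in `S`. -/
noncomputable def prob (M : ContinualMechanism U T) (x : TurnstileStream U T)
    (S : Set (Fin T → ℝ)) : ℝ :=
  (@Measure.real M.Coins M.mCoins M.law) {ω | M.output x ω ∈ S}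

/-- `(ε, δ)`-item-level differential privacy. -/
def IsItemLevelDP (M : ContinualMechanism U T) (ε δ : ℝ) : Prop :=
  ∀ x x' : TurnstileStream U T, TurnstileStream.ItemNeighbors x x' →
    ∀ S : Set (Fin T → ℝ), MeasurableSet S →
      M.prob x S ≤ Real.exp ε * M.prob x' S + δ

/-- On the stream `x`, with probability at least `0.99`, the error for `countDistinct` is at
most `α`. -/
def IsAccurateOn (M : ContinualMechanism U T) (x : TurnstileStream U T) (α : ℝ) : Prop :=
  0.99 ≤ M.prob x {a | x.countDistinctError a ≤ α}

end ContinualMechanism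

/-! For a cap `w`, count only the elements that have flipped fewer than `w` times so far. The
contribution of one element over time then has increments of absolute value at most 1, and over
disjoint time intervals at most `w` of them are nonzero. Write the capped count at each time as a
sum of at most `L ≈ log T` dyadic increments. Changing one item moves the vector of increments of
one level by at most `2√w` in Euclidean norm (`ItemNeighbors.sum_sq_nodeValue_sub_le`). Gaussian
noise of size `σ√w` per node makes this private (`stdGaussianPi_privacy`), with an error of order
`√w · B` up to powers of `log T`, where `B = √(log(1/δ)) / ε`.

The value `w_x` need not be known. All caps `2 ^ i` are released together, at the price of another
logarithm in the noise. A capped count never exceeds the true count, so each noisy one, lowered by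
its noise bound, is a lower confidence bound, and their maximum is as good as the best cap
(`abs_countDistinct_sub_maxLowerEstimate_le`).

Two caps give the theorem. A cap above `w_x + 1` has no bias, so the error is about `√w_x · B`. For
any cap the bias is at most `T / w`, because the flips of all elements together number at most `T`;
balancing `T / w` with `√w · B` gives `(T B²)^(1/3)`. Extreme parameters are left to trivial
mechanisms. -/

section GaussianMechanism

/-! ### Gaussian noise: change of measure, tails and privacy. -/

open ProbabilityTheory

/-- The standard Gaussian measure on `ι → ℝ`. -/
noncomputable def stdGaussianPi (ι : Type*) [Fintype ι] : Measure (ι → ℝ) :=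
  Measure.pi fun _ => gaussianReal 0 1

variable {ι : Type*} [Fintype ι]

instance : IsProbabilityMeasure (stdGaussianPi ι) := by
  unfold stdGaussianPi; infer_instance

theorem gaussianReal_one_eq_withDensity (v : ℝ) :
    gaussianReal v 1 =
      (gaussianReal 0 1).withDensity fun y => ENNReal.ofReal (Real.exp (v * y - v ^ 2 / 2)) := by
  rw [gaussianReal_of_var_ne_zero _ one_ne_zero, gaussianReal_of_var_ne_zero _ one_ne_zero,
    ← withDensity_mul _ (measurable_gaussianPDF _ _) (by fun_prop)]
  congr 1
  ext y
  simp only [Pi.mul_apply, gaussianPDF, gaussianPDFReal]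
  rw [← ENNReal.ofReal_mul (by positivity), mul_assoc _ (Real.exp _), ← Real.exp_add]
  congr 3
  simp
  ring

/-- A product measure is determined by its values on boxes. On a box the exponential density is a
product of functions of single coordinates, so independence reduces the claim to dimension one. -/
theorem stdGaussianPi_map_add (v : ι → ℝ) :
    (stdGaussianPi ι).map (fun z => z + v) = (stdGaussianPi ι).withDensity
      fun y => ENNReal.ofReal (Real.exp (∑ i, (v i * y i - v i ^ 2 / 2))) := by
  have h1 : (stdGaussianPi ι).map (fun z => z + v) = Measure.pi fun i => gaussianReal (v i) 1 := by
    have := Measure.pi_map_pi (μ := fun _ : ι => gaussianReal 0 1) (f := fun i z => z + v i)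
      (fun i => by fun_prop)
    simp only [gaussianReal_map_add_const, zero_add] at this
    exact this
  rw [h1]
  refine Measure.pi_eq fun s hs => ?_
  rw [withDensity_apply _ (MeasurableSet.univ_pi hs), ← lintegral_indicator (MeasurableSet.univ_pi hs)]
  have hprod : ∀ y : ι → ℝ, (Set.univ.pi s).indicator
      (fun y => ENNReal.ofReal (Real.exp (∑ i, (v i * y i - v i ^ 2 / 2)))) y =
      ∏ i, (s i).indicator (fun t => ENNReal.ofReal (Real.exp (v i * t - v i ^ 2 / 2))) (y i) := by
    intro y
    by_cases hy : y ∈ Set.univ.pi s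
    · rw [Set.indicator_of_mem hy, Real.exp_sum, ENNReal.ofReal_prod_of_nonneg
        fun i _ => (Real.exp_pos _).le]
      exact Finset.prod_congr rfl fun i _ => by rw [Set.indicator_of_mem (hy i trivial)]
    · rw [Set.indicator_of_notMem hy]
      simp only [Set.mem_pi, not_forall] at hy
      obtain ⟨i, -, hi⟩ := hy
      exact (Finset.prod_eq_zero (Finset.mem_univ i) (Set.indicator_of_notMem hi _)).symm
  have hm : ∀ i, Measurable ((s i).indicator
      fun t => ENNReal.ofReal (Real.exp (v i * t - v i ^ 2 / 2))) :=
    fun i => Measurable.indicator (by fun_prop) (hs i)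
  simp_rw [hprod]
  have hind : iIndepFun (fun i (y : ι → ℝ) => (s i).indicator
      (fun t => ENNReal.ofReal (Real.exp (v i * t - v i ^ 2 / 2))) (y i)) (stdGaussianPi ι) := by
    have h0 := iIndepFun_pi (μ := fun _ : ι => gaussianReal 0 1) (X := fun _ => id)
      fun _ => aemeasurable_id
    exact h0.comp _ hm
  rw [lintegral_prod_eq_prod_lintegral_of_indepFun Finset.univ _ hind
    fun i => (hm i).comp (measurable_pi_apply i)]
  refine Finset.prod_congr rfl fun i _ => ?_
  rw [gaussianReal_one_eq_withDensity, withDensity_apply _ (hs i), ← lintegral_indicator (hs i)]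
  exact (measurePreserving_eval (fun _ : ι => gaussianReal 0 1) i).lintegral_comp (hm i)

theorem hasSubgaussianMGF_gaussianReal : HasSubgaussianMGF id 1 (gaussianReal 0 1) where
  integrable_exp_mul t := by
    simpa using integrable_exp_mul_gaussianReal (μ := 0) (v := 1) t
  mgf_le t := by
    rw [mgf_id_gaussianReal]; simp

theorem hasSubgaussianMGF_eval (i : ι) :
    HasSubgaussianMGF (fun z : ι → ℝ => z i) 1 (stdGaussianPi ι) := by
  have h := (measurePreserving_eval (fun _ : ι => gaussianReal 0 1) i)
  refine HasSubgaussianMGF.of_map (Y := fun z : ι → ℝ => z i) (X := id)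
    (measurable_pi_apply i).aemeasurable ?_
  have h2 : Measure.map (fun z : ι → ℝ => z i) (stdGaussianPi ι) = gaussianReal 0 1 := h.map_eq
  rw [h2]
  exact hasSubgaussianMGF_gaussianReal

theorem stdGaussianPi_inner_ge_le (v : ι → ℝ) {c : ℝ} (hc : 0 ≤ c) :
    (stdGaussianPi ι).real {z | c ≤ ∑ i, v i * z i} ≤ Real.exp (-c ^ 2 / (2 * ∑ i, v i ^ 2)) := by
  have hind : iIndepFun (fun i (z : ι → ℝ) => v i * z i) (stdGaussianPi ι) :=
    iIndepFun_pi (μ := fun _ : ι => gaussianReal 0 1) (X := fun i t => v i * t) fun _ => by fun_prop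
  have := HasSubgaussianMGF.measure_sum_ge_le_of_iIndepFun hind (s := Finset.univ)
    (fun i _ => (hasSubgaussianMGF_eval i).const_mul (v i)) hc
  convert this using 4
  push_cast
  exact Finset.sum_congr rfl fun i _ => (mul_one _).symm

/-- With probability at least `0.99`, no coordinate of a standard Gaussian vector is large. -/
theorem stdGaussianPi_abs_le {R : ℝ} (hR : 0 ≤ R)
    (h : Fintype.card ι * (2 * Real.exp (-R ^ 2 / 2)) ≤ 0.01) :
    0.99 ≤ (stdGaussianPi ι).real {z | ∀ i, |z i| ≤ R} := by
  have hcompl : {z : ι → ℝ | ∀ i, |z i| ≤ R}ᶜ ⊆ ⋃ i, ({z | R ≤ z i} ∪ {z | R ≤ - z i}) := by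
    intro z hz
    simp only [Set.mem_compl_iff, Set.mem_ofPred_eq, not_forall, not_le] at hz
    obtain ⟨i, hi⟩ := hz
    refine Set.mem_iUnion.2 ⟨i, ?_⟩
    rcases lt_abs.1 hi with h | h
    · exact Or.inl h.le
    · exact Or.inr h.le
  have hms : MeasurableSet {z : ι → ℝ | ∀ i, |z i| ≤ R} := by
    have : {z : ι → ℝ | ∀ i, |z i| ≤ R} = ⋂ i, {z | |z i| ≤ R} := by ext; simp
    rw [this]
    exact MeasurableSet.iInter fun i => measurableSet_le (by fun_prop) measurable_const
  have h1 : (stdGaussianPi ι).real {z : ι → ℝ | ∀ i, |z i| ≤ R}ᶜ ≤ 0.01 := by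
    refine (measureReal_mono hcompl).trans ((measureReal_iUnion_fintype_le _).trans ?_)
    refine (Finset.sum_le_card_nsmul _ _ (2 * Real.exp (-R ^ 2 / 2)) fun i _ => ?_).trans
      (by simpa using h)
    refine (measureReal_union_le _ _).trans ?_
    have e1 := (hasSubgaussianMGF_eval i).measure_ge_le hR
    have e2 := (hasSubgaussianMGF_eval i).neg.measure_ge_le hR
    simp only [NNReal.coe_one, mul_one, Pi.neg_apply] at e1 e2
    linarith
  rw [probReal_compl_eq_one_sub hms] at h1
  linarith

/-- The privacy guarantee of the Gaussian mechanism. -/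
theorem stdGaussianPi_privacy {ε δ : ℝ} (hε : 0 < ε) (hε1 : ε ≤ 1) (hδ : 0 < δ) (hδ1 : δ ≤ 1)
    (a b : ι → ℝ) (hab : ∑ i, (a i - b i) ^ 2 ≤ ε ^ 2 / (4 * (1 + Real.log (1 / δ))))
    {S : Set (ι → ℝ)} (hS : MeasurableSet S) :
    (stdGaussianPi ι).real {z | a + z ∈ S} ≤
      Real.exp ε * (stdGaussianPi ι).real {z | b + z ∈ S} + δ := by
  set γ := stdGaussianPi ι
  set v : ι → ℝ := a - b with hv
  set Q : ℝ := ∑ i, v i ^ 2 with hQ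
  have hℓ : 0 ≤ Real.log (1 / δ) := Real.log_nonneg (by rw [le_div_iff₀ hδ]; linarith)
  have hQ0 : 0 ≤ Q := Finset.sum_nonneg fun i _ => sq_nonneg _
  have hQ1 : Q * (4 * (1 + Real.log (1 / δ))) ≤ ε ^ 2 := by
    rw [← le_div_iff₀ (by positivity)]; exact hab
  have hQ2 : 4 * Q ≤ ε ^ 2 := by nlinarith [mul_nonneg hQ0 hℓ]
  have hQ3 : 7 / 8 * ε ≤ ε - Q / 2 := by nlinarith
  set A : Set (ι → ℝ) := {z | b + z ∈ S} with hA
  have hAm : MeasurableSet A := by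
    have : Measurable fun z : ι → ℝ => b + z := by fun_prop
    exact this hS
  set f : (ι → ℝ) → ℝ := fun y => ∑ i, (v i * y i - v i ^ 2 / 2) with hf
  have hfm : Measurable f := by fun_prop
  -- On `G` the likelihood ratio is at most `exp ε`, which gives the multiplicative term. The
  -- complement of `G` is a Gaussian tail event and is charged to `δ`.
  set G : Set (ι → ℝ) := {y | f y ≤ ε} with hG
  have hGm : MeasurableSet G := measurableSet_le hfm measurable_const
  have htrans : Measurable fun z : ι → ℝ => z + v := by fun_prop
  have hpre : {z | a + z ∈ S} = (fun z => z + v) ⁻¹' A := by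
    ext z
    simp only [hA, hv, Set.mem_ofPred_eq, Set.mem_preimage]
    rw [show b + (z + (a - b)) = a + z by abel]
  have hsub : {z | a + z ∈ S} ⊆ (fun z => z + v) ⁻¹' (A ∩ G) ∪ (fun z => z + v) ⁻¹' Gᶜ := by
    rw [hpre]
    intro z hz
    by_cases hg : z + v ∈ G
    · exact Or.inl ⟨hz, hg⟩
    · exact Or.inr hg
  refine (measureReal_mono hsub).trans ((measureReal_union_le _ _).trans (add_le_add ?_ ?_))
  · have h1 : γ ((fun z => z + v) ⁻¹' (A ∩ G)) ≤ ENNReal.ofReal (Real.exp ε) * γ A := by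
      rw [← Measure.map_apply htrans (hAm.inter hGm), stdGaussianPi_map_add,
        withDensity_apply _ (hAm.inter hGm)]
      calc _ ≤ ∫⁻ y in A ∩ G, ENNReal.ofReal (Real.exp ε) ∂γ :=
            setLIntegral_mono measurable_const fun y hy =>
              ENNReal.ofReal_le_ofReal (Real.exp_le_exp.2 hy.2)
        _ = ENNReal.ofReal (Real.exp ε) * γ (A ∩ G) := setLIntegral_const _ _
        _ ≤ _ := by gcongr; exact Set.inter_subset_left
    have h2 := ENNReal.toReal_mono (ENNReal.mul_ne_top ENNReal.ofReal_ne_top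
      (measure_ne_top γ A)) h1
    rwa [ENNReal.toReal_mul, ENNReal.toReal_ofReal (Real.exp_pos _).le] at h2
  · have hsub2 : (fun z => z + v) ⁻¹' Gᶜ ⊆ {z | ε - Q / 2 ≤ ∑ i, v i * z i} := by
      intro z hz
      simp only [hG, Set.mem_preimage, Set.mem_compl_iff, Set.mem_ofPred_eq, not_le, hf] at hz ⊢
      have : ∑ i, (v i * (z + v) i - v i ^ 2 / 2) = ∑ i, v i * z i + Q / 2 := by
        rw [hQ, Finset.sum_div, ← Finset.sum_add_distrib]
        exact Finset.sum_congr rfl fun i _ => by simp only [Pi.add_apply]; ring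
      linarith
    -- For `Q = 0` the exponent of the tail bound is a division by zero and the bound degenerates to
    -- 1.
    by_cases hQz : Q = 0
    · have hv0 : ∀ i, v i = 0 := fun i => by
        have := (Finset.sum_eq_zero_iff_of_nonneg fun i _ => sq_nonneg (v i)).1 hQz i
          (Finset.mem_univ i)
        exact pow_eq_zero_iff two_ne_zero |>.1 this
      have : (fun z => z + v) ⁻¹' Gᶜ = (∅ : Set (ι → ℝ)) := by
        ext z
        simp [hG, hf, hv0, hε.le]
      rw [this, measureReal_empty]
      exact hδ.le
    refine (measureReal_mono hsub2).trans ((stdGaussianPi_inner_ge_le v (by nlinarith)).trans ?_)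
    rw [← hQ, ← Real.le_log_iff_exp_le hδ]
    have hQpos : 0 < Q := lt_of_le_of_ne hQ0 (Ne.symm hQz)
    rw [div_le_iff₀ (by positivity)]
    have hlog : Real.log δ = - Real.log (1 / δ) := by rw [one_div, Real.log_inv]; ring
    rw [hlog]
    have : (7 / 8 * ε) ^ 2 ≤ (ε - Q / 2) ^ 2 := pow_le_pow_left₀ (by positivity) hQ3 2
    nlinarith [mul_nonneg hQ0 hℓ]

end GaussianMechanism

/-! ### Dyadic increments of a capped parity. -/

section DyadicNodes

/-- The parity of `k`, replaced by `0` as soon as `k` reaches the cap `w`. -/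
noncomputable def truncParity (w k : ℕ) : ℝ := if k < w then ((k % 2 : ℕ) : ℝ) else 0

theorem truncParity_zero (w : ℕ) : truncParity w 0 = 0 := by simp [truncParity]

theorem truncParity_nonneg (w k : ℕ) : 0 ≤ truncParity w k := by
  unfold truncParity; split_ifs <;> positivity

theorem truncParity_le (w k : ℕ) : truncParity w k ≤ (k % 2 : ℕ) := by
  unfold truncParity; split_ifs
  · exact le_rfl
  · positivity

theorem truncParity_le_one (w k : ℕ) : truncParity w k ≤ 1 :=
  (truncParity_le w k).trans (by exact_mod_cast (Nat.mod_lt k two_pos).le_pred)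

/-- If the capped counts agree, then `k = k'` or both have reached the cap, where the value is 0.
Otherwise the right side is at least 1 and both values lie in `[0, 1]`. The right side telescopes
over consecutive intervals. -/
theorem sq_truncParity_sub_le {w k k' : ℕ} (h : k ≤ k') :
    (truncParity w k' - truncParity w k) ^ 2 ≤ (min k' w : ℕ) - (min k w : ℕ) := by
  rcases eq_or_ne (min k w) (min k' w) with he | hne
  · have : truncParity w k' = truncParity w k := by
      unfold truncParity
      rcases eq_or_ne k k' with rfl | hk
      · rfl
      · rw [if_neg (by omega), if_neg (by omega)]
    simp [this, he]
  · have h1 : ((min k w : ℕ) : ℝ) + 1 ≤ (min k' w : ℕ) := by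
      exact_mod_cast (by omega : min k w + 1 ≤ min k' w)
    nlinarith [truncParity_nonneg w k, truncParity_nonneg w k', truncParity_le_one w k,
      truncParity_le_one w k']

/-- The increment of `h ∘ k` over the dyadic interval of level `l` that ends at `b * 2 ^ l`
(`0` if `b` is even). -/
def dyadicNode (h : ℕ → ℝ) (k : ℕ → ℕ) (l b : ℕ) : ℝ :=
  h (k (b * 2 ^ l)) - h (k (b / 2 * 2 ^ (l + 1)))

theorem sum_dyadicNode (h : ℕ → ℝ) (k : ℕ → ℕ) {n L : ℕ} (hn : n < 2 ^ L) :
    ∑ l ∈ Finset.range L, dyadicNode h k l (n / 2 ^ l) = h (k n) - h (k 0) := by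
  have h1 : ∀ l, dyadicNode h k l (n / 2 ^ l) =
      h (k (n / 2 ^ l * 2 ^ l)) - h (k (n / 2 ^ (l + 1) * 2 ^ (l + 1))) := fun l => by
    rw [dyadicNode, Nat.div_div_eq_div_mul, ← pow_succ]
  simp_rw [h1]
  rw [Finset.sum_range_sub' (fun l => h (k (n / 2 ^ l * 2 ^ l)))]
  simp [Nat.div_eq_of_lt hn]

theorem sum_sq_dyadicNode_le {k : ℕ → ℕ} (hk : Monotone k) (w l N : ℕ) :
    ∑ b ∈ Finset.range (N + 1), dyadicNode (truncParity w) k l b ^ 2 ≤ w := by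
  have key : ∑ b ∈ Finset.range (N + 1), dyadicNode (truncParity w) k l b ^ 2 ≤
      (min (k (N * 2 ^ l)) w : ℕ) := by
    induction N with
    | zero => simp [dyadicNode]
    | succ N ih =>
      rw [Finset.sum_range_succ]
      have hm : k (N * 2 ^ l) ≤ k ((N + 1) * 2 ^ l) := hk (Nat.mul_le_mul_right _ N.le_succ)
      have hstep : dyadicNode (truncParity w) k l (N + 1) ^ 2 ≤
          (min (k ((N + 1) * 2 ^ l)) w : ℕ) - (min (k (N * 2 ^ l)) w : ℕ) := by
        unfold dyadicNode
        -- For even `N` the node `N + 1` covers exactly the interval from `N * 2 ^ l` to `(N + 1) *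
        -- 2 ^ l`; for odd `N` it is zero.
        rcases Nat.even_or_odd' N with ⟨c, hc | hc⟩
        · have : (N + 1) / 2 * 2 ^ (l + 1) = N * 2 ^ l := by
            rw [show (N + 1) / 2 = c by omega, hc, pow_succ]; ring
          rw [this]
          exact sq_truncParity_sub_le hm
        · have : (N + 1) / 2 * 2 ^ (l + 1) = (N + 1) * 2 ^ l := by
            rw [show (N + 1) / 2 = c + 1 by omega, hc, pow_succ]; ring
          rw [this, sub_self, zero_pow two_ne_zero, sub_nonneg]
          exact_mod_cast min_le_min_right w hm
      linarith
  exact key.trans (by exact_mod_cast min_le_right _ _)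

end DyadicNodes

/-! ### Flips of elements and the bias of capped counts. -/

namespace TurnstileStream

variable {U : Type*} {T : ℕ}

/-- The existence of `u` after the first `n` entries. -/
noncomputable def existenceAfter (x : TurnstileStream U T) (u : U) (n : ℕ) : ℕ :=
  if Set.ncard {s : Fin T | (s : ℕ) < n ∧ x s = StreamEntry.del u} <
    Set.ncard {s : Fin T | (s : ℕ) < n ∧ x s = StreamEntry.ins u} then 1 else 0

theorem existence_eq_existenceAfter (x : TurnstileStream U T) (u : U) (t : Fin T) :
    x.existence u t = x.existenceAfter u (t + 1) := by
  have h : ∀ s : Fin T, s ≤ t ↔ (s : ℕ) < t + 1 := fun s => by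
    rw [Fin.le_def]; omega
  simp only [existence, existenceAfter, insertions, deletions, h]

theorem existenceAfter_le_one (x : TurnstileStream U T) (u : U) (n : ℕ) :
    x.existenceAfter u n ≤ 1 := by
  unfold existenceAfter; split_ifs <;> omega

theorem existenceAfter_zero (x : TurnstileStream U T) (u : U) : x.existenceAfter u 0 = 0 := by
  simp [existenceAfter]

theorem existenceAfter_congr {x x' : TurnstileStream U T} {u : U} {n : ℕ}
    (h : ∀ s : Fin T, (s : ℕ) < n → ((x s = .ins u ↔ x' s = .ins u) ∧
      (x s = .del u ↔ x' s = .del u))) :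
    x.existenceAfter u n = x'.existenceAfter u n := by
  have h1 : {s : Fin T | (s : ℕ) < n ∧ x s = StreamEntry.ins u} =
      {s : Fin T | (s : ℕ) < n ∧ x' s = StreamEntry.ins u} := by
    ext s; exact and_congr_right fun hs => (h s hs).1
  have h2 : {s : Fin T | (s : ℕ) < n ∧ x s = StreamEntry.del u} =
      {s : Fin T | (s : ℕ) < n ∧ x' s = StreamEntry.del u} := by
    ext s; exact and_congr_right fun hs => (h s hs).2
  rw [existenceAfter, existenceAfter, h1, h2]

theorem exists_pertainsTo_of_existenceAfter_ne {x : TurnstileStream U T} {u : U} {n : ℕ}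
    (h : x.existenceAfter u n ≠ x.existenceAfter u (n + 1)) :
    ∃ s : Fin T, (s : ℕ) = n ∧ (x s).PertainsTo u := by
  by_contra! hcon
  have aux : ∀ e : StreamEntry U, (e = .ins u ∨ e = .del u) →
      {s : Fin T | (s : ℕ) < n ∧ x s = e} = {s : Fin T | (s : ℕ) < n + 1 ∧ x s = e} := by
    intro e he
    ext s
    refine ⟨fun hs => ⟨hs.1.trans n.lt_succ_self, hs.2⟩, fun hs => ⟨?_, hs.2⟩⟩
    refine lt_of_le_of_ne (Nat.lt_succ_iff.1 hs.1) fun hsn => hcon s hsn ?_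
    rw [hs.2]
    exact he
  apply h
  rw [existenceAfter, existenceAfter, aux _ (Or.inl rfl), aux _ (Or.inr rfl)]

/-- The number of changes of the existence of `u` among the first `n` entries; the element is
absent at the start. -/
noncomputable def flipsUpTo (x : TurnstileStream U T) (u : U) (n : ℕ) : ℕ :=
  ((Finset.range n).filter fun j => x.existenceAfter u j ≠ x.existenceAfter u (j + 1)).card

theorem flipsUpTo_zero (x : TurnstileStream U T) (u : U) : x.flipsUpTo u 0 = 0 := by
  simp [flipsUpTo]

theorem flipsUpTo_succ (x : TurnstileStream U T) (u : U) (n : ℕ) :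
    x.flipsUpTo u (n + 1) = x.flipsUpTo u n +
      if x.existenceAfter u n ≠ x.existenceAfter u (n + 1) then 1 else 0 := by
  rw [flipsUpTo, Finset.range_add_one, Finset.filter_insert]
  split_ifs with h
  · rw [Finset.card_insert_of_notMem (by simp)]; rfl
  · rfl

theorem flipsUpTo_mono (x : TurnstileStream U T) (u : U) : Monotone (x.flipsUpTo u) :=
  monotone_nat_of_le_succ fun n => by rw [flipsUpTo_succ]; exact Nat.le_add_right _ _

theorem flipsUpTo_le (x : TurnstileStream U T) (u : U) (n : ℕ) : x.flipsUpTo u n ≤ n :=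
  (Finset.card_filter_le _ _).trans (by simp)

theorem flipsUpTo_mod_two (x : TurnstileStream U T) (u : U) (n : ℕ) :
    x.flipsUpTo u n % 2 = x.existenceAfter u n := by
  induction n with
  | zero => simp [flipsUpTo_zero, existenceAfter_zero]
  | succ n ih =>
    rw [flipsUpTo_succ]
    have h1 := x.existenceAfter_le_one u n
    have h2 := x.existenceAfter_le_one u (n + 1)
    split_ifs <;> omega

theorem flipsUpTo_congr {x x' : TurnstileStream U T} {u : U} {n : ℕ}
    (h : ∀ s : Fin T, (s : ℕ) < n → ((x s = .ins u ↔ x' s = .ins u) ∧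
      (x s = .del u ↔ x' s = .del u))) :
    x.flipsUpTo u n = x'.flipsUpTo u n := by
  unfold flipsUpTo
  congr 1
  refine Finset.filter_congr fun j hj => ?_
  have hj := Finset.mem_range.1 hj
  rw [existenceAfter_congr fun s hs => h s (by omega), existenceAfter_congr fun s hs => h s (by omega)]

/-- The extra 1 is a possible change from the initial absence at the first entry, index `0`, which
`flippancy` does not see. -/
theorem flipsUpTo_le_flippancy (x : TurnstileStream U T) (u : U) {n : ℕ} (hn : n ≤ T) :
    x.flipsUpTo u n ≤ x.flippancy u + 1 := by
  set A := (Finset.range n).filter fun j => x.existenceAfter u j ≠ x.existenceAfter u (j + 1)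
  set P : Set (Fin T × Fin T) := {p | (p.1 : ℕ) + 1 = p.2 ∧ x.existence u p.1 ≠ x.existence u p.2}
  have hsub : (A.erase 0 : Set ℕ) ⊆ (fun p : Fin T × Fin T => (p.2 : ℕ)) '' P := by
    intro j hj
    simp only [A, Finset.coe_erase, Finset.coe_filter, Finset.mem_range, Set.mem_sdiff,
      Set.mem_ofPred_eq, Set.mem_singleton_iff] at hj
    obtain ⟨⟨hjn, hne⟩, hj0⟩ := hj
    refine ⟨(⟨j - 1, by omega⟩, ⟨j, by omega⟩), ⟨by simp; omega, ?_⟩, rfl⟩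
    simp only [existence_eq_existenceAfter]
    rwa [Nat.sub_add_cancel (by omega)]
  have h1 : (A.erase 0).card ≤ x.flippancy u := by
    rw [← Set.ncard_coe_finset]
    exact (Set.ncard_le_ncard hsub (Set.toFinite _)).trans (Set.ncard_image_le (Set.toFinite _))
  have h2 : A.card - 1 ≤ (A.erase 0).card := Finset.pred_card_le_card_erase
  have h3 : x.flipsUpTo u n = A.card := rfl
  omega

theorem flipsUpTo_le_maxFlippancy (x : TurnstileStream U T) (u : U) {n : ℕ} (hn : n ≤ T) :
    x.flipsUpTo u n ≤ x.maxFlippancy + 1 :=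
  (x.flipsUpTo_le_flippancy u hn).trans
    (Nat.add_le_add_right (le_ciSup x.bddAbove_range_flippancy u) 1)

theorem finite_pertainsTo (x : TurnstileStream U T) :
    {u : U | ∃ s, (x s).PertainsTo u}.Finite := by
  have h1 : (StreamEntry.ins ⁻¹' Set.range x : Set U).Finite :=
    (Set.finite_range x).preimage fun a _ b _ hab => by injection hab
  have h2 : (StreamEntry.del ⁻¹' Set.range x : Set U).Finite :=
    (Set.finite_range x).preimage fun a _ b _ hab => by injection hab
  refine (h1.union h2).subset ?_
  rintro u ⟨s, hs | hs⟩
  · exact Or.inl ⟨s, hs⟩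
  · exact Or.inr ⟨s, hs⟩

/-- The elements that occur in the stream. -/
noncomputable def items (x : TurnstileStream U T) : Finset U := x.finite_pertainsTo.toFinset

theorem flipsUpTo_eq_zero {x : TurnstileStream U T} {u : U} (hu : u ∉ x.items) (n : ℕ) :
    x.flipsUpTo u n = 0 := by
  rw [flipsUpTo, Finset.card_eq_zero, Finset.filter_eq_empty_iff]
  intro j _ hne
  obtain ⟨s, -, hs⟩ := exists_pertainsTo_of_existenceAfter_ne hne
  exact hu (x.finite_pertainsTo.mem_toFinset.2 ⟨s, hs⟩)

theorem _root_.StreamEntry.PertainsTo.unique {e : StreamEntry U} {u v : U}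
    (hu : e.PertainsTo u) (hv : e.PertainsTo v) : u = v := by
  rcases hu with rfl | rfl <;> rcases hv with h | h <;> injection h

/-- Every entry changes the existence of at most one element. -/
theorem sum_flipsUpTo_le (x : TurnstileStream U T) (S : Finset U) (n : ℕ) :
    ∑ u ∈ S, x.flipsUpTo u n ≤ n := by
  induction n with
  | zero => simp [flipsUpTo_zero]
  | succ n ih =>
    simp_rw [flipsUpTo_succ]
    rw [Finset.sum_add_distrib, ← Finset.card_filter]
    refine Nat.add_le_add ih (Finset.card_le_one.2 fun u hu v hv => ?_)
    obtain ⟨s, hs, hsu⟩ := exists_pertainsTo_of_existenceAfter_ne (Finset.mem_filter.1 hu).2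
    obtain ⟨s', hs', hsv⟩ := exists_pertainsTo_of_existenceAfter_ne (Finset.mem_filter.1 hv).2
    obtain rfl : s = s' := Fin.ext (hs.trans hs'.symm)
    exact hsu.unique hsv

theorem countDistinct_eq_sum (x : TurnstileStream U T) (t : Fin T) :
    x.countDistinct t = ∑ u ∈ x.items, x.flipsUpTo u (t + 1) % 2 := by
  rw [countDistinct]
  simp_rw [existence_eq_existenceAfter, ← flipsUpTo_mod_two]
  refine finsum_eq_sum_of_support_subset _ fun u hu => ?_
  by_contra hne
  exact hu (by simp [flipsUpTo_eq_zero hne])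

theorem countDistinct_le (x : TurnstileStream U T) (t : Fin T) : x.countDistinct t ≤ T := by
  rw [countDistinct_eq_sum]
  exact (Finset.sum_le_sum fun u _ => Nat.mod_le _ _).trans
    ((x.sum_flipsUpTo_le _ _).trans t.isLt)

/-- The number of distinct elements after `n` entries, where elements whose existence has changed
at least `w` times are not counted. -/
noncomputable def truncCount (x : TurnstileStream U T) (w n : ℕ) : ℝ :=
  ∑ᶠ u : U, truncParity w (x.flipsUpTo u n)

theorem truncCount_eq_sum (x : TurnstileStream U T) (w n : ℕ) :
    x.truncCount w n = ∑ u ∈ x.items, truncParity w (x.flipsUpTo u n) := by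
  refine finsum_eq_sum_of_support_subset _ fun u hu => ?_
  by_contra hne
  exact hu (by simp [flipsUpTo_eq_zero hne, truncParity_zero])

theorem truncCount_le (x : TurnstileStream U T) (w : ℕ) (t : Fin T) :
    x.truncCount w (t + 1) ≤ x.countDistinct t := by
  rw [truncCount_eq_sum, countDistinct_eq_sum, Nat.cast_sum]
  exact Finset.sum_le_sum fun u _ => truncParity_le _ _

theorem countDistinct_le_truncCount (x : TurnstileStream U T) (t : Fin T) {w : ℕ}
    (hw : ∀ u, x.flipsUpTo u (t + 1) < w) : (x.countDistinct t : ℝ) ≤ x.truncCount w (t + 1) := by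
  rw [truncCount_eq_sum, countDistinct_eq_sum, Nat.cast_sum]
  exact Finset.sum_le_sum fun u _ => by rw [truncParity, if_pos (hw u)]

/-- An uncounted element has used at least `w` flips, and all elements share at most `T` flips. -/
theorem countDistinct_le_truncCount_add (x : TurnstileStream U T) (t : Fin T) {w : ℕ}
    (hw : 0 < w) : (x.countDistinct t : ℝ) ≤ x.truncCount w (t + 1) + T / w := by
  have hw' : (0 : ℝ) < w := by exact_mod_cast hw
  have hterm : ∀ k : ℕ, ((k % 2 : ℕ) : ℝ) ≤ truncParity w k + k / w := by
    intro k
    unfold truncParity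
    split_ifs with hk
    · exact le_add_of_nonneg_right (by positivity)
    · have h1 : ((k % 2 : ℕ) : ℝ) ≤ 1 := by exact_mod_cast (Nat.mod_lt k two_pos).le_pred
      have h2 : (1 : ℝ) ≤ k / w := by
        rw [le_div_iff₀ hw', one_mul]; exact_mod_cast not_lt.1 hk
      linarith
  rw [truncCount_eq_sum, countDistinct_eq_sum, Nat.cast_sum]
  refine (Finset.sum_le_sum fun u _ => hterm _).trans ?_
  rw [Finset.sum_add_distrib, ← Finset.sum_div]
  gcongr
  exact_mod_cast (x.sum_flipsUpTo_le x.items (t + 1)).trans t.isLt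

/-! ### Dyadic nodes of a stream and their sensitivity. -/

/-- The sum over all elements of the increments of the truncated existence over a dyadic
interval. -/
noncomputable def nodeValue (x : TurnstileStream U T) (w l b : ℕ) : ℝ :=
  ∑ᶠ u : U, dyadicNode (truncParity w) (x.flipsUpTo u) l b

theorem nodeValue_eq_sum (x : TurnstileStream U T) (w l b : ℕ) {S : Finset U} (hS : x.items ⊆ S) :
    x.nodeValue w l b = ∑ u ∈ S, dyadicNode (truncParity w) (x.flipsUpTo u) l b := by
  refine finsum_eq_sum_of_support_subset _ fun u hu => ?_
  by_contra hne
  have hne' : u ∉ x.items := fun h => hne (hS h)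
  exact hu (by simp [dyadicNode, flipsUpTo_eq_zero hne'])

theorem sum_nodeValue (x : TurnstileStream U T) (w : ℕ) {n L : ℕ} (hn : n < 2 ^ L) :
    ∑ l ∈ Finset.range L, x.nodeValue w l (n / 2 ^ l) = x.truncCount w n := by
  simp_rw [fun l => x.nodeValue_eq_sum w l (n / 2 ^ l) subset_rfl]
  rw [Finset.sum_comm, truncCount_eq_sum]
  refine Finset.sum_congr rfl fun u _ => ?_
  rw [sum_dyadicNode _ _ hn, flipsUpTo_zero, truncParity_zero, sub_zero]

theorem nodeValue_congr {x x' : TurnstileStream U T} {n : ℕ}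
    (h : ∀ s : Fin T, (s : ℕ) < n → x s = x' s) (w l : ℕ) :
    x.nodeValue w l (n / 2 ^ l) = x'.nodeValue w l (n / 2 ^ l) := by
  have h1 : n / 2 ^ l * 2 ^ l ≤ n := Nat.div_mul_le_self _ _
  have h2 : n / 2 ^ l / 2 * 2 ^ (l + 1) ≤ n := by
    rw [Nat.div_div_eq_div_mul, ← pow_succ]; exact Nat.div_mul_le_self _ _
  have h3 : ∀ u m, m ≤ n → x.flipsUpTo u m = x'.flipsUpTo u m := fun u m hm =>
    flipsUpTo_congr fun s hs => by rw [h s (by omega)]; exact ⟨Iff.rfl, Iff.rfl⟩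
  unfold nodeValue dyadicNode
  congr 1
  ext u
  rw [h3 u _ h1, h3 u _ h2]

/-- Erasing entries of `u` leaves the flips of every other element unchanged, so all other summands
cancel. -/
theorem IsItemErasure.exists_nodeValue_sub_eq {x x' : TurnstileStream U T}
    (h : IsItemErasure x x') : ∃ u, ∀ w l b, x.nodeValue w l b - x'.nodeValue w l b =
      dyadicNode (truncParity w) (x.flipsUpTo u) l b -
        dyadicNode (truncParity w) (x'.flipsUpTo u) l b := by
  classical
  obtain ⟨u, hu⟩ := h
  refine ⟨u, fun w l b => ?_⟩
  have hflips : ∀ v, v ≠ u → x.flipsUpTo v = x'.flipsUpTo v := by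
    intro v hv
    ext n
    refine flipsUpTo_congr fun s _ => ?_
    rcases hu s with hs | ⟨hs, hs'⟩
    · rw [hs]; exact ⟨Iff.rfl, Iff.rfl⟩
    · have h1 : ¬ (x s).PertainsTo v := fun h => hv (h.unique hs)
      rw [hs']
      exact ⟨⟨fun h => absurd (Or.inl h) h1, fun h => by injection h⟩,
        ⟨fun h => absurd (Or.inr h) h1, fun h => by injection h⟩⟩
  set S := insert u (x.items ∪ x'.items) with hS
  have hx : x.items ⊆ S := fun v hv => by simp [hS, hv]
  have hx' : x'.items ⊆ S := fun v hv => by simp [hS, hv]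
  rw [x.nodeValue_eq_sum w l b hx, x'.nodeValue_eq_sum w l b hx', ← Finset.sum_sub_distrib]
  refine Finset.sum_eq_single u (fun v _ hv => ?_) fun hu => absurd (by simp [hS]) hu
  rw [hflips v hv, sub_self]

/-- The histories of the changed element in the two streams may be unrelated; each has square sum at
most `w`, and `(p - q)² ≤ 2p² + 2q²` gives the factor 4. -/
theorem ItemNeighbors.sum_sq_nodeValue_sub_le {x x' : TurnstileStream U T}
    (h : ItemNeighbors x x') (w l N : ℕ) :
    ∑ b ∈ Finset.range (N + 1), (x.nodeValue w l b - x'.nodeValue w l b) ^ 2 ≤ 4 * (w : ℝ) := by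
  have main : ∀ {x x' : TurnstileStream U T}, IsItemErasure x x' →
      ∑ b ∈ Finset.range (N + 1), (x.nodeValue w l b - x'.nodeValue w l b) ^ 2 ≤ 4 * (w : ℝ) := by
    intro x x' h
    obtain ⟨u, hu⟩ := h.exists_nodeValue_sub_eq
    have h1 := sum_sq_dyadicNode_le (x.flipsUpTo_mono u) w l N
    have h2 := sum_sq_dyadicNode_le (x'.flipsUpTo_mono u) w l N
    have h3 : ∀ p q : ℝ, (p - q) ^ 2 ≤ 2 * p ^ 2 + 2 * q ^ 2 := fun p q => by
      nlinarith [sq_nonneg (p + q)]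
    calc ∑ b ∈ Finset.range (N + 1), (x.nodeValue w l b - x'.nodeValue w l b) ^ 2
        _ ≤ ∑ b ∈ Finset.range (N + 1), (2 * dyadicNode (truncParity w) (x.flipsUpTo u) l b ^ 2 +
            2 * dyadicNode (truncParity w) (x'.flipsUpTo u) l b ^ 2) :=
          Finset.sum_le_sum fun b _ => by rw [hu]; exact h3 _ _
        _ ≤ 4 * (w : ℝ) := by
          rw [Finset.sum_add_distrib, ← Finset.mul_sum, ← Finset.mul_sum]; linarith
  rcases h with h | h
  · exact main h
  · have := main h
    simp_rw [fun b => sub_sq_comm (x.nodeValue w l b) (x'.nodeValue w l b)]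
    exact this

end TurnstileStream

/-! ### The mechanism that releases all caps at once. -/

section TruncationMechanism

variable {U : Type*} {T : ℕ}

/-- The truncated node values for the caps `2 ^ i`, scaled to noise of variance `1`. -/
noncomputable def TurnstileStream.scaledNodes (x : TurnstileStream U T) (L : ℕ) (σ : ℝ) :
    Fin (L + 1) × Fin L × Fin (T + 1) → ℝ :=
  fun p => x.nodeValue (2 ^ (p.1 : ℕ)) p.2.1 p.2.2 / (σ * √(2 ^ (p.1 : ℕ)))

/-- Dividing by `√w` makes the bound `4 / σ ^ 2` for a cap and a level independent of the cap; there
are `L + 1` caps and `L` levels. -/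
theorem TurnstileStream.ItemNeighbors.sum_sq_scaledNodes_sub_le {x x' : TurnstileStream U T}
    (h : ItemNeighbors x x') (L : ℕ) {σ : ℝ} (hσ : 0 < σ) :
    ∑ p, (x.scaledNodes L σ p - x'.scaledNodes L σ p) ^ 2 ≤ 4 * L * (L + 1) / σ ^ 2 := by
  have hrow : ∀ (i : Fin (L + 1)) (l : Fin L), ∑ b : Fin (T + 1),
      (x.scaledNodes L σ (i, l, b) - x'.scaledNodes L σ (i, l, b)) ^ 2 ≤ 4 / σ ^ 2 := by
    intro i l
    have h1 : ∀ b : Fin (T + 1),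
        (x.scaledNodes L σ (i, l, b) - x'.scaledNodes L σ (i, l, b)) ^ 2 =
        (x.nodeValue (2 ^ (i : ℕ)) l b - x'.nodeValue (2 ^ (i : ℕ)) l b) ^ 2 /
          (σ ^ 2 * 2 ^ (i : ℕ)) := fun b => by
      simp only [scaledNodes]
      rw [← sub_div, div_pow, mul_pow, Real.sq_sqrt (by positivity)]
    simp_rw [h1]
    rw [← Finset.sum_div, Fin.sum_univ_eq_sum_range fun b =>
      (x.nodeValue (2 ^ (i : ℕ)) l b - x'.nodeValue (2 ^ (i : ℕ)) l b) ^ 2,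
      div_le_div_iff₀ (by positivity) (by positivity)]
    have h2 := h.sum_sq_nodeValue_sub_le (2 ^ (i : ℕ)) l T
    push_cast at h2
    nlinarith [sq_nonneg σ]
  rw [Fintype.sum_prod_type]
  simp_rw [Fintype.sum_prod_type]
  refine (Finset.sum_le_sum fun i _ => Finset.sum_le_sum fun l _ => hrow i l).trans (le_of_eq ?_)
  simp
  ring

/-- The level-`l` node used to count up to time `t`. -/
def nodeIndex (t : Fin T) (l : ℕ) : Fin (T + 1) :=
  ⟨(t + 1) / 2 ^ l, Nat.lt_succ_of_le ((Nat.div_le_self _ _).trans t.isLt)⟩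

/-- The lower confidence bound for the number of distinct elements obtained from the noisy
nodes for the cap `2 ^ i`, if the noise in each node is at most `R`. -/
noncomputable def lowerEstimate (L : ℕ) (σ R : ℝ) (y : Fin (L + 1) × Fin L × Fin (T + 1) → ℝ)
    (t : Fin T) (i : Fin (L + 1)) : ℝ :=
  σ * √(2 ^ (i : ℕ)) * (∑ l : Fin L, y (i, l, nodeIndex t l) - L * R)

/-- The largest of the lower confidence bounds. -/
noncomputable def maxLowerEstimate (L : ℕ) (σ R : ℝ)
    (y : Fin (L + 1) × Fin L × Fin (T + 1) → ℝ) (t : Fin T) : ℝ :=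
  Finset.univ.sup' Finset.univ_nonempty (lowerEstimate L σ R y t)

theorem measurable_maxLowerEstimate (L : ℕ) (σ R : ℝ) :
    Measurable (maxLowerEstimate L σ R (T := T)) := by
  refine measurable_pi_lambda _ fun t => ?_
  have : (fun y => maxLowerEstimate L σ R y t) = Finset.univ.sup' Finset.univ_nonempty
      fun i y => lowerEstimate L σ R y t i := by
    ext y
    rw [Finset.sup'_apply]
    rfl
  rw [this]
  refine Finset.measurable_sup' _ fun i _ => ?_
  unfold lowerEstimate
  fun_prop

theorem lowerEstimate_scaledNodes_add (x : TurnstileStream U T) {L : ℕ} (hL : T < 2 ^ L) {σ : ℝ}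
    (hσ : 0 < σ) (R : ℝ) (z : Fin (L + 1) × Fin L × Fin (T + 1) → ℝ) (t : Fin T)
    (i : Fin (L + 1)) :
    lowerEstimate L σ R (x.scaledNodes L σ + z) t i = x.truncCount (2 ^ (i : ℕ)) (t + 1) +
      σ * √(2 ^ (i : ℕ)) * (∑ l : Fin L, z (i, l, nodeIndex t l) - L * R) := by
  have h0 : σ * √(2 ^ (i : ℕ)) ≠ 0 := by positivity
  have h1 : ∑ l : Fin L, x.scaledNodes L σ (i, l, nodeIndex t l) =
      x.truncCount (2 ^ (i : ℕ)) (t + 1) / (σ * √(2 ^ (i : ℕ))) := by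
    rw [← x.sum_nodeValue _ (lt_of_le_of_lt t.isLt hL), Finset.sum_div,
      ← Fin.sum_univ_eq_sum_range fun l => x.nodeValue (2 ^ (i : ℕ)) l ((t + 1) / 2 ^ l) /
        (σ * √(2 ^ (i : ℕ)))]
    rfl
  unfold lowerEstimate
  simp only [Pi.add_apply]
  rw [Finset.sum_add_distrib, h1]
  field_simp
  ring

/-- No estimate exceeds the truth, whatever its cap, so taking the maximum costs nothing from above.
From below, the maximum is at least the estimate for the one cap `2 ^ i`, whose noise and downward
shift each cost at most `σ√(2 ^ i) · L R`. -/
theorem abs_countDistinct_sub_maxLowerEstimate_le (x : TurnstileStream U T) {L : ℕ}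
    (hL : T < 2 ^ L) {σ : ℝ} (hσ : 0 < σ) {R : ℝ}
    {z : Fin (L + 1) × Fin L × Fin (T + 1) → ℝ} (hz : ∀ p, |z p| ≤ R) (t : Fin T)
    (i : Fin (L + 1)) {c : ℝ}
    (hc : (x.countDistinct t : ℝ) ≤ x.truncCount (2 ^ (i : ℕ)) (t + 1) + c) :
    |(x.countDistinct t : ℝ) - maxLowerEstimate L σ R (x.scaledNodes L σ + z) t| ≤
      c + 2 * (σ * √(2 ^ (i : ℕ)) * (L * R)) := by
  have hsum : ∀ j : Fin (L + 1), |∑ l : Fin L, z (j, l, nodeIndex t l)| ≤ L * R := fun j =>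
    (Finset.abs_sum_le_sum_abs _ _).trans
      ((Finset.sum_le_card_nsmul _ _ R fun l _ => hz _).trans (by simp))
  have hLR : 0 ≤ L * R := (abs_nonneg _).trans (hsum i)
  have hs : ∀ j : Fin (L + 1), 0 < σ * √(2 ^ (j : ℕ)) := fun j => by positivity
  have hupper : maxLowerEstimate L σ R (x.scaledNodes L σ + z) t ≤ x.countDistinct t := by
    refine Finset.sup'_le _ _ fun j _ => ?_
    rw [lowerEstimate_scaledNodes_add x hL hσ]
    have := mul_nonneg (hs j).le (sub_nonneg.2 ((le_abs_self _).trans (hsum j)))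
    linarith [x.truncCount_le (2 ^ (j : ℕ)) t]
  have hlower : x.truncCount (2 ^ (i : ℕ)) (t + 1) - 2 * (σ * √(2 ^ (i : ℕ)) * (L * R)) ≤
      maxLowerEstimate L σ R (x.scaledNodes L σ + z) t := by
    refine le_trans ?_ (Finset.le_sup' _ (Finset.mem_univ i))
    rw [lowerEstimate_scaledNodes_add x hL hσ]
    have h1 : -(L * R) ≤ ∑ l : Fin L, z (i, l, nodeIndex t l) := (abs_le.1 (hsum i)).1
    have := mul_le_mul_of_nonneg_left (a := σ * √(2 ^ (i : ℕ))) h1 (hs i).le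
    linarith
  have := mul_nonneg (hs i).le hLR
  rw [abs_le]
  constructor <;> linarith

/-- The mechanism that releases the best lower confidence bound from Gaussian noise on the
truncated dyadic counts. -/
noncomputable def truncationMechanism (U : Type*) (T L : ℕ) (σ R : ℝ) : ContinualMechanism U T where
  Coins := Fin (L + 1) × Fin L × Fin (T + 1) → ℝ
  mCoins := inferInstance
  law := stdGaussianPi _
  isProbabilityMeasure_law := inferInstance
  output x z := maxLowerEstimate L σ R (x.scaledNodes L σ + z)
  measurable_output x := (measurable_maxLowerEstimate L σ R).comp (by fun_prop)
  online x x' t h z := by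
    have h1 : ∀ i (l : Fin L), x.scaledNodes L σ (i, l, nodeIndex t l) =
        x'.scaledNodes L σ (i, l, nodeIndex t l) := fun i l => by
      simp only [TurnstileStream.scaledNodes, nodeIndex]
      rw [TurnstileStream.nodeValue_congr fun s hs => h s (Fin.le_def.2 (Nat.lt_succ_iff.1 hs))]
    unfold maxLowerEstimate lowerEstimate
    simp only [Pi.add_apply, h1]

theorem truncationMechanism_isItemLevelDP {L : ℕ} {σ ε δ : ℝ} (R : ℝ) (hσ : 0 < σ) (hε : 0 < ε)
    (hε1 : ε ≤ 1) (hδ : 0 < δ) (hδ1 : δ ≤ 1)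
    (h : 4 * L * (L + 1) / σ ^ 2 ≤ ε ^ 2 / (4 * (1 + Real.log (1 / δ)))) :
    (truncationMechanism U T L σ R).IsItemLevelDP ε δ := fun x x' hx _ hS =>
  stdGaussianPi_privacy hε hε1 hδ hδ1 (x.scaledNodes L σ) (x'.scaledNodes L σ)
    ((hx.sum_sq_scaledNodes_sub_le L hσ).trans h) (measurable_maxLowerEstimate L σ R hS)

theorem truncationMechanism_isAccurateOn {L : ℕ} (hL : T < 2 ^ L) {σ R : ℝ} (hσ : 0 < σ)
    (hR : 0 ≤ R)
    (hR' : ((L + 1) * L * (T + 1) : ℕ) * (2 * Real.exp (-R ^ 2 / 2)) ≤ 0.01)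
    (x : TurnstileStream U T) {α : ℝ} {i : ℕ} (hi : i ≤ L) {c : ℝ} (hc0 : 0 ≤ c)
    (hc : ∀ t, (x.countDistinct t : ℝ) ≤ x.truncCount (2 ^ i) (t + 1) + c)
    (hα : c + 2 * (σ * √(2 ^ i) * (L * R)) ≤ α) :
    (truncationMechanism U T L σ R).IsAccurateOn x α := by
  refine (stdGaussianPi_abs_le (ι := Fin (L + 1) × Fin L × Fin (T + 1)) hR ?_).trans ?_
  · simpa [mul_assoc] using hR'
  refine @measureReal_mono _ _ (stdGaussianPi _) _ _ ?_ (measure_ne_top _ _)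
  intro z hz
  have key := fun t => abs_countDistinct_sub_maxLowerEstimate_le x hL hσ hz t
    ⟨i, Nat.lt_succ_of_le hi⟩ (hc t)
  have h0 : 0 ≤ R * L := by positivity
  refine (pi_norm_le_iff_of_nonneg ?_).2 fun t => (key t).trans hα
  exact le_trans (by positivity) hα

end TruncationMechanism

/-! ### Mechanisms for extreme parameters. -/

section TrivialMechanisms

variable {U : Type*} {T : ℕ}

theorem countDistinct_congr {x x' : TurnstileStream U T} {t : Fin T} (h : ∀ s ≤ t, x s = x' s) :
    x.countDistinct t = x'.countDistinct t := by
  unfold TurnstileStream.countDistinct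
  simp_rw [TurnstileStream.existence_eq_existenceAfter]
  refine finsum_congr fun u => TurnstileStream.existenceAfter_congr fun s hs => ?_
  rw [h s (Fin.le_def.2 (Nat.lt_succ_iff.1 hs))]
  exact ⟨Iff.rfl, Iff.rfl⟩

/-- The mechanism that gives the exact answers with probability `p`, and answers `0` otherwise. -/
noncomputable def exactWithProb (U : Type*) (T : ℕ) (p : unitInterval) :
    ContinualMechanism U T where
  Coins := Bool
  mCoins := inferInstance
  law := ProbabilityTheory.bernoulliMeasure true false p
  isProbabilityMeasure_law := inferInstance
  output x ω t := if ω then x.countDistinct t else 0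
  measurable_output _ := measurable_of_countable _
  online x x' t h ω := by rw [countDistinct_congr h]

open scoped Classical in
theorem exactWithProb_prob (p : unitInterval) (x : TurnstileStream U T) (S : Set (Fin T → ℝ)) :
    (exactWithProb U T p).prob x S =
      (if (fun t => (x.countDistinct t : ℝ)) ∈ S then (p : ℝ) else 0) +
        if (0 : Fin T → ℝ) ∈ S then 1 - (p : ℝ) else 0 := by
  have h1 : (exactWithProb U T p).prob x S = (ProbabilityTheory.bernoulliMeasure true false p).real
      {ω | (fun t => if ω then (x.countDistinct t : ℝ) else 0) ∈ S} := rfl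
  have h2 : (0 : Fin T → ℝ) = fun _ => 0 := rfl
  rw [h1, ProbabilityTheory.bernoulliMeasure_real_apply p (Set.toFinite _).measurableSet, h2]
  by_cases hx : (fun t => (x.countDistinct t : ℝ)) ∈ S <;>
    by_cases h0 : (fun _ => 0 : Fin T → ℝ) ∈ S <;> simp [hx, h0]

/-- The outputs on two streams can differ only in the event of probability `p` that the exact
answers are given. -/
theorem exactWithProb_isItemLevelDP (p : unitInterval) {ε δ : ℝ} (hε : 0 ≤ ε) (hδ : p ≤ δ) :
    (exactWithProb U T p).IsItemLevelDP ε δ := by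
  classical
  intro x x' _ S _
  have h1 : 1 ≤ Real.exp ε := Real.one_le_exp hε
  have h2 : (exactWithProb U T p).prob x S ≤ (exactWithProb U T p).prob x' S + p := by
    rw [exactWithProb_prob, exactWithProb_prob]
    split_ifs <;> linarith [p.2.1, p.2.2]
  have h3 : 0 ≤ (exactWithProb U T p).prob x' S := measureReal_nonneg
  nlinarith

theorem exactWithProb_isAccurateOn (p : unitInterval) (h : 0.99 ≤ (p : ℝ))
    (x : TurnstileStream U T) {α : ℝ} (hα : 0 ≤ α) :
    (exactWithProb U T p).IsAccurateOn x α := by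
  classical
  rw [ContinualMechanism.IsAccurateOn, exactWithProb_prob, if_pos (by
    simpa [TurnstileStream.countDistinctError] using hα)]
  split_ifs <;> linarith [p.2.2]

theorem exactWithProb_zero_isAccurateOn (x : TurnstileStream U T) {α : ℝ} (hα : T ≤ α) :
    (exactWithProb U T 0).IsAccurateOn x α := by
  classical
  have h0 : (0 : Fin T → ℝ) ∈ {a | x.countDistinctError a ≤ α} := by
    refine (pi_norm_le_iff_of_nonneg ((Nat.cast_nonneg T).trans hα)).2 fun t => ?_
    simp only [Pi.sub_apply, Pi.zero_apply, sub_zero, Real.norm_natCast]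
    exact le_trans (by exact_mod_cast x.countDistinct_le t) hα
  rw [ContinualMechanism.IsAccurateOn, exactWithProb_prob, if_pos h0]
  norm_num

end TrivialMechanisms

/-! ### Numerical choice of the noise level and the tail bound. -/

section Parameters

/-- The parameters of the truncation mechanism for streams of length `T`: the number of dyadic
levels, the noise level and the tail bound. -/
theorem exists_truncationMechanism {T : ℕ} (hT : 2 ≤ T) {ε δ B : ℝ} (hε : 0 < ε) (hε1 : ε ≤ 1)
    (hδ : 0 < δ) (hδ1 : δ < 0.99) (hB : B = √(Real.logb 2 (1 / δ)) / ε) (U : Type*) :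
    ∃ M : ContinualMechanism U T, M.IsItemLevelDP ε δ ∧
      ∀ (x : TurnstileStream U T) (i : ℕ), i ≤ Nat.log 2 T + 1 → ∀ c : ℝ, 0 ≤ c →
        (∀ t, (x.countDistinct t : ℝ) ≤ x.truncCount (2 ^ i) (t + 1) + c) →
        ∀ α : ℝ, c + 3168 * Real.logb 2 T ^ 3 * (√(2 ^ i) * B) ≤ α → M.IsAccurateOn x α := by
  set lam := Real.logb 2 T with hlam
  have hT' : (2 : ℝ) ≤ T := by exact_mod_cast hT
  have hlam1 : 1 ≤ lam := by
    rw [hlam, Real.le_logb_iff_rpow_le one_lt_two (by linarith), Real.rpow_one]; exact hT'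
  obtain ⟨L, hLdef⟩ : ∃ L, L = Nat.log 2 T + 1 := ⟨_, rfl⟩
  have hTL : T < 2 ^ L := hLdef ▸ Nat.lt_pow_succ_log_self one_lt_two T
  have hLlam : (L : ℝ) ≤ 2 * lam := by
    have h1 : (Nat.log 2 T : ℝ) ≤ lam := by
      have := Real.natLog_le_logb T 2
      exact_mod_cast this
    rw [hLdef]; push_cast; linarith
  set ℓ := Real.log (1 / δ) with hℓ
  set Lδ := Real.logb 2 (1 / δ) with hLδ
  have hinv : 1 / 0.99 ≤ 1 / δ := one_div_le_one_div_of_le hδ hδ1.le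
  have hℓ0 : 0.01 ≤ ℓ := by
    have h1 := Real.one_sub_inv_le_log_of_pos (x := 1 / δ) (by positivity)
    rw [one_div, inv_inv] at h1
    rw [hℓ, one_div]; linarith
  have hℓL : ℓ ≤ Lδ := by
    rw [hLδ, Real.logb, le_div_iff₀ (Real.log_pos one_lt_two)]
    have : Real.log 2 ≤ 1 := by linarith [Real.log_two_lt_d9]
    nlinarith
  -- Since `δ < 0.99`, `ℓ ≥ 0.01` and hence `1 + ℓ ≤ 101 ℓ`; this absorbs the additive 1 of the
  -- privacy condition.
  have hsqrt : √(1 + ℓ) ≤ 11 * √Lδ := by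
    rw [Real.sqrt_le_left (by positivity), mul_pow, Real.sq_sqrt (by linarith)]
    linarith
  set σ := 4 * (L + 1) * √(1 + ℓ) / ε with hσdef
  have hσ : 0 < σ := by
    have : 0 < √(1 + ℓ) := Real.sqrt_pos.2 (by linarith)
    positivity
  have hσB : σ ≤ 132 * lam * B := by
    have h1 : σ ≤ 4 * (3 * lam) * (11 * √Lδ) / ε := by
      rw [hσdef]; gcongr; linarith
    rw [hB]
    refine h1.trans (le_of_eq ?_)
    ring
  have hB0 : 0 ≤ B := by rw [hB]; positivity
  -- With the tail bound `6 * lam`, a coordinate is too large with probability at most `2 T⁻¹⁴`,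
  -- against at most `8 T³` coordinates.
  refine ⟨truncationMechanism U T L σ (6 * lam), ?_, ?_⟩
  · refine truncationMechanism_isItemLevelDP _ hσ hε hε1 hδ (by linarith) ?_
    rw [hσdef, div_pow, mul_pow, Real.sq_sqrt (by linarith), div_div_eq_mul_div,
      div_le_div_iff₀ (by positivity) (by positivity)]
    have h1 : (0 : ℝ) ≤ ε ^ 2 * (L + 1) * (1 + ℓ) := by positivity
    nlinarith
  · intro x i hi c hc0 hc α hα
    refine truncationMechanism_isAccurateOn hTL hσ (by positivity) ?_ x (hLdef ▸ hi) hc0 hc ?_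
    · have hexp : Real.exp (-(6 * lam) ^ 2 / 2) ≤ ((T : ℝ) ^ 14)⁻¹ := by
        have h1 : Real.log T ≤ lam := by
          rw [hlam, Real.logb, le_div_iff₀ (Real.log_pos one_lt_two)]
          have : Real.log 2 ≤ 1 := by linarith [Real.log_two_lt_d9]
          nlinarith [Real.log_nonneg (show (1 : ℝ) ≤ T by linarith)]
        rw [← Real.le_log_iff_exp_le (by positivity), Real.log_inv, Real.log_pow]
        push_cast
        nlinarith
      have hL2 : L + 1 ≤ 2 * T := by
        have h1 : L < 2 ^ L := Nat.lt_two_pow_self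
        have h2 : 2 ^ Nat.log 2 T ≤ T := Nat.pow_log_le_self 2 (by omega)
        have h3 : 2 ^ L = 2 * 2 ^ Nat.log 2 T := by rw [hLdef, pow_succ]; ring
        omega
      have hcard : (L + 1) * L * (T + 1) ≤ (2 * T) * (2 * T) * (2 * T) := by
        gcongr <;> omega
      have hcard' : (((L + 1) * L * (T + 1) : ℕ) : ℝ) ≤ 8 * (T : ℝ) ^ 3 := by
        refine (Nat.cast_le.2 hcard).trans (le_of_eq ?_)
        push_cast
        ring
      calc (((L + 1) * L * (T + 1) : ℕ) : ℝ) * (2 * Real.exp (-(6 * lam) ^ 2 / 2))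
          ≤ 8 * (T : ℝ) ^ 3 * (2 * ((T : ℝ) ^ 14)⁻¹) := by gcongr
        _ = 16 * ((T : ℝ) ^ 11)⁻¹ := by field_simp; ring
        _ ≤ 16 * ((2 : ℝ) ^ 11)⁻¹ := by gcongr
        _ ≤ 0.01 := by norm_num
    · refine le_trans ?_ hα
      -- The constant is `3168 = 2 · 132 · 2 · 6`.
      have : σ * √(2 ^ i) * (L * (6 * lam)) ≤
          132 * lam * B * √(2 ^ i) * (2 * lam * (6 * lam)) := by gcongr
      linarith

end Parameters

/-! ### Choice of the mechanism and, in its analysis, of the cap. -/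

theorem theorem1p5 :
    ∃ (C : ℝ) (k T₀ : ℕ), 0 < C ∧
      ∀ (U : Type*) (ε δ : ℝ), 0 < ε → ε ≤ 1 → 0 < δ → δ ≤ 1 →
        ∀ T : ℕ, T₀ ≤ T →
          ∃ M : ContinualMechanism U T, M.IsItemLevelDP ε δ ∧
            ∀ x : TurnstileStream U T,
              M.IsAccurateOn x
                (C * Real.logb 2 T ^ k *
                  min ((√(x.maxFlippancy : ℝ) * Real.logb 2 T + Real.logb 2 T ^ 3) *
                        (√(Real.logb 2 (1 / δ)) / ε))
                    (min ((T * Real.logb 2 (1 / δ)) ^ (1 / 3 : ℝ) / ε ^ (2 / 3 : ℝ))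
                      (T : ℝ))) := by
  refine ⟨6336, 3, 2, by norm_num, fun U ε δ hε hε1 hδ hδ1 T hT => ?_⟩
  have hT' : (2 : ℝ) ≤ T := by exact_mod_cast hT
  have hLδ : 0 ≤ Real.logb 2 (1 / δ) :=
    Real.logb_nonneg one_lt_two (by rw [le_div_iff₀ hδ]; linarith)
  have hlam1 : 1 ≤ Real.logb 2 T := by
    rw [Real.le_logb_iff_rpow_le one_lt_two (by linarith), Real.rpow_one]; exact hT'
  -- As `δ` tends to 1 the error bound tends to 0, so exact answers are needed; giving them with
  -- probability `δ` is private.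
  rcases le_or_gt 0.99 δ with hδ2 | hδ2
  · refine ⟨exactWithProb U T ⟨δ, hδ.le, hδ1⟩, exactWithProb_isItemLevelDP _ hε.le le_rfl,
      fun x => exactWithProb_isAccurateOn _ hδ2 x ?_⟩
    have : 0 ≤ Real.logb 2 T := by linarith
    positivity
  obtain ⟨M, hM, hacc⟩ := exists_truncationMechanism hT hε hε1 hδ hδ2 rfl U
  obtain ⟨B, hB⟩ : ∃ B, B = √(Real.logb 2 (1 / δ)) / ε := ⟨_, rfl⟩
  obtain ⟨X, hX⟩ : ∃ X, X = (T * Real.logb 2 (1 / δ)) ^ (1 / 3 : ℝ) / ε ^ (2 / 3 : ℝ) := ⟨_, rfl⟩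
  have hLδpos : 0 < Real.logb 2 (1 / δ) :=
    Real.logb_pos one_lt_two (by rw [lt_div_iff₀ hδ]; linarith)
  have hBpos : 0 < B := by rw [hB]; positivity
  have hXpos : 0 < X := by rw [hX]; positivity
  -- This says that the cap `w = (X / B) ^ 2` balances bias and noise: `T / w = X = √w * B`.
  have hX3 : X ^ 3 = T * B ^ 2 := by
    rw [hX, hB, div_pow, div_pow, Real.sq_sqrt hLδ, ← Real.rpow_natCast, ← Real.rpow_mul (by positivity),
      ← Real.rpow_natCast (ε ^ (2 / 3 : ℝ)), ← Real.rpow_mul hε.le, ← Real.rpow_natCast ε]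
    norm_num
    ring
  rw [← hB] at hacc
  rw [← hB, ← hX]
  set lam := Real.logb 2 T with hlam
  have hlam3 : 1 ≤ lam ^ 3 := one_le_pow₀ hlam1
  -- If `B > T`, both other terms of the minimum are at least `T`, and the answer 0 is accurate
  -- enough.
  rcases lt_or_ge (T : ℝ) B with hTB | hTB
  · refine ⟨exactWithProb U T 0, exactWithProb_isItemLevelDP _ hε.le hδ.le,
      fun x => exactWithProb_zero_isAccurateOn x ?_⟩
    have h1 : (T : ℝ) ≤ (√(x.maxFlippancy : ℝ) * lam + lam ^ 3) * B := by
      have : 0 ≤ √(x.maxFlippancy : ℝ) * lam := by positivity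
      nlinarith
    have h2 : (T : ℝ) ≤ X := by
      refine le_of_pow_le_pow_left₀ three_ne_zero hXpos.le ?_
      rw [hX3, pow_succ']
      gcongr
    have h3 := le_min h1 (le_min h2 le_rfl)
    have h4 : 1 ≤ 6336 * lam ^ 3 := by linarith
    nlinarith
  refine ⟨M, hM, fun x => ?_⟩
  have hfirst : ∀ α, 6336 * lam ^ 3 * ((√(x.maxFlippancy : ℝ) * lam + lam ^ 3) * B) ≤ α →
      M.IsAccurateOn x α := by
    intro α hα
    -- `k` bounds the flips of every element. The minimum with `T` keeps the next power of two among
    -- the available caps.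
    obtain ⟨k, hk⟩ : ∃ k, k = min (x.maxFlippancy + 1) T := ⟨_, rfl⟩
    have hk0 : k ≠ 0 := by omega
    have hkT : k ≤ T := hk ▸ min_le_right _ _
    have hkw : k ≤ x.maxFlippancy + 1 := hk ▸ min_le_left _ _
    refine hacc x (Nat.log 2 k + 1) (Nat.succ_le_succ (Nat.log_mono_right hkT)) 0
      le_rfl (fun t => ?_) α ?_
    · rw [add_zero]
      refine x.countDistinct_le_truncCount t fun u => ?_
      refine lt_of_le_of_lt ?_ (Nat.lt_pow_succ_log_self one_lt_two k)
      rw [hk]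
      exact le_min (x.flipsUpTo_le_maxFlippancy u t.isLt) ((x.flipsUpTo_le u _).trans t.isLt)
    · refine le_trans ?_ hα
      have h1 : (2 : ℝ) ^ (Nat.log 2 k + 1) ≤ 2 * (x.maxFlippancy + 1) := by
        have h2 := Nat.pow_log_le_self 2 hk0
        have : 2 ^ (Nat.log 2 k + 1) ≤ 2 * (x.maxFlippancy + 1) := by
          rw [pow_succ]; omega
        exact_mod_cast this
      have h2 : √((2 : ℝ) ^ (Nat.log 2 k + 1)) ≤ 2 * (√(x.maxFlippancy : ℝ) * lam + lam ^ 3) := by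
        have h3 : 0 ≤ √(x.maxFlippancy : ℝ) := Real.sqrt_nonneg _
        have h4 := Real.sq_sqrt (Nat.cast_nonneg (α := ℝ) x.maxFlippancy)
        have h5 : √(x.maxFlippancy : ℝ) + 1 ≤ √(x.maxFlippancy : ℝ) * lam + lam ^ 3 := by nlinarith
        refine le_trans ?_ (mul_le_mul_of_nonneg_left h5 zero_le_two)
        rw [Real.sqrt_le_left (by positivity)]
        nlinarith
      have h3 : √((2 : ℝ) ^ (Nat.log 2 k + 1)) * B ≤
          2 * (√(x.maxFlippancy : ℝ) * lam + lam ^ 3) * B := by gcongr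
      have h4 := mul_le_mul_of_nonneg_left h3 (show 0 ≤ 3168 * lam ^ 3 by positivity)
      linarith
  have hsecond : ∀ α, 6336 * lam ^ 3 * X ≤ α → M.IsAccurateOn x α := by
    intro α hα
    have hBX : B ≤ X := by
      refine le_of_pow_le_pow_left₀ three_ne_zero hXpos.le ?_
      rw [hX3, pow_succ']
      gcongr
    obtain ⟨w, hw⟩ : ∃ w, w = (X / B) ^ 2 := ⟨_, rfl⟩
    have hXB : 1 ≤ X / B := by rwa [le_div_iff₀ hBpos, one_mul]
    have hw1 : 1 ≤ w := hw ▸ one_le_pow₀ hXB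
    have hTw : T / w = X := by
      rw [hw]; field_simp; linarith
    obtain ⟨i, hi⟩ : ∃ i, i = Nat.log 2 ⌊w⌋₊ := ⟨_, rfl⟩
    have hfloor : ⌊w⌋₊ ≠ 0 := (Nat.floor_pos.2 hw1).ne'
    have hi1 : (2 : ℝ) ^ i ≤ w := by
      have h1 : 2 ^ i ≤ ⌊w⌋₊ := hi ▸ Nat.pow_log_le_self 2 hfloor
      exact le_trans (by exact_mod_cast h1) (Nat.floor_le (by linarith))
    have hi2 : w ≤ 2 * 2 ^ i := by
      have h1 : ⌊w⌋₊ + 1 ≤ 2 ^ (i + 1) := hi ▸ Nat.lt_pow_succ_log_self one_lt_two ⌊w⌋₊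
      have h2 : ((⌊w⌋₊ + 1 : ℕ) : ℝ) ≤ ((2 ^ (i + 1) : ℕ) : ℝ) := Nat.cast_le.2 h1
      push_cast at h2
      linarith [Nat.lt_floor_add_one w, pow_succ' (2 : ℝ) i]
    have hnoise : ∀ j ≤ i, 3168 * lam ^ 3 * (√(2 ^ j) * B) ≤ 3168 * lam ^ 3 * X := by
      intro j hj
      have h1 : √((2 : ℝ) ^ j) ≤ X / B := by
        rw [Real.sqrt_le_left (by linarith), ← hw]
        exact le_trans (pow_le_pow_right₀ one_le_two hj) hi1
      exact mul_le_mul_of_nonneg_left ((le_div_iff₀ hBpos).1 h1) (by positivity)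
    have hX3' : X ≤ lam ^ 3 * X := le_mul_of_one_le_left hXpos.le hlam3
    rcases le_or_gt i (Nat.log 2 T + 1) with hiL | hiL
    · refine hacc x i hiL (T / (2 ^ i : ℕ)) (by positivity)
        (fun t => x.countDistinct_le_truncCount_add t (by positivity)) α (le_trans ?_ hα)
      have h1 : (T : ℝ) / (2 ^ i : ℕ) ≤ 2 * X := by
        rw [← hTw, mul_div_assoc', div_le_div_iff₀ (by positivity) (by linarith)]
        push_cast
        nlinarith
      linarith [hnoise i le_rfl]
    -- The balancing cap is not available here; the largest one exceeds `T`, so it has no bias, and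
    -- it has less noise than the balancing cap.
    · refine hacc x (Nat.log 2 T + 1) le_rfl 0 le_rfl (fun t => ?_) α (le_trans ?_ hα)
      · rw [add_zero]
        refine x.countDistinct_le_truncCount t fun u => ?_
        exact lt_of_le_of_lt ((x.flipsUpTo_le u _).trans t.isLt)
          (Nat.lt_pow_succ_log_self one_lt_two T)
      · linarith [hnoise _ hiL.le]
  have hC : 0 ≤ 6336 * lam ^ 3 := by positivity
  rcases min_choice ((√(x.maxFlippancy : ℝ) * lam + lam ^ 3) * B) (min X T) with h | h
  · rw [h]
    exact hfirst _ le_rfl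
  · rw [h]
    -- Since `B ≤ T`, the term `T` never decides the minimum.
    have hXT : X ≤ T := by
      refine le_of_pow_le_pow_left₀ three_ne_zero (by linarith) ?_
      rw [hX3, pow_succ' (T : ℝ) 2]
      gcongr
    rw [min_eq_left hXT]
    exact hsecond _ le_rfl
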